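/- Let $p\ge 5$ be a prime and let $E$ be an elliptic curve over $\mathbb{Q}$ with good ordinary reduction at $p$ (that is, good reduction with $p\nmid a_p=p+1-\#\tilde E(\mathbb{F}_p)$). Let $E_{p^\infty}$ be the Galois module of $p$-power torsion points of $E$, let $\Sigma$ be a finite set of primes containing $p$ and all primes of bad reduction of $E$, and let $\mathbb{Q}_\Sigma$ be the maximal extension of $\mathbb{Q}$ in $\overline{\mathbb{Q}}$ in which all primes $l\notin\Sigma$ are unramified. For a subfield $L\subseteq\mathbb{Q}_\Sigma$ put $$\operatorname{Sel}(E/L)=\ker\Big(H^1(\operatorname{Gal}(\mathbb{Q}_\Sigma/L),E_{p^\infty})\longrightarrow\prod_{l\in\Sigma}\ \prod_{w\mid l}H^1(L_w,E)_{p^\infty}\Big),$$ where $w$ runs over the primes of $L$ above $l$, $L_w$ is the union of the completions at $w$ of the number fields contained in $L$, $H^1$ is continuous Galois cohomology with discrete coefficients, and the subscript $p^\infty$ denotes the $p$-primary subgroup. Let $\mathbb{Q}^{\mathrm{cyc}}\subset\mathbb{Q}(\mu_{p^\infty})$ be the cyclotomic $\mathbb{Z}_p$-extension of $\mathbb{Q}$,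 and let $\Delta=\ker\big(\operatorname{Gal}(\mathbb{Q}(\mu_{p^\infty})/\mathbb{Q})\to\operatorname{Gal}(\mathbb{Q}^{\mathrm{cyc}}/\mathbb{Q})\big)$. Then the restriction map $H^1(\operatorname{Gal}(\mathbb{Q}_\Sigma/\mathbb{Q}^{\mathrm{cyc}}),E_{p^\infty})\to H^1(\operatorname{Gal}(\mathbb{Q}_\Sigma/\mathbb{Q}(\mu_{p^\infty})),E_{p^\infty})$ induces an isomorphism $$\operatorname{Sel}(E/\mathbb{Q}^{\mathrm{cyc}})\;\cong\;\operatorname{Sel}(E/\mathbb{Q}(\mu_{p^\infty}))^{\Delta},$$ where $\Delta$ acts on the Selmer group by conjugation. -/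

import Mathlib

open scoped NumberField

-- Extensions of `ℚ` carry the algebra structure they were constructed with.
attribute [local instance 2000] IntermediateField.algebra' AlgebraicClosure.instAlgebra

/-! ### First continuous cohomology with discrete coefficients -/

section Cohomology

variable {G H A B : Type*} [Group G] [TopologicalSpace G] [Group H] [TopologicalSpace H]
  [AddCommGroup A] [AddCommGroup B]

/-- The group `Z¹(G, A)` of continuous crossed homomorphisms `G → A`, where the topological group
`G` acts on the discrete abelian group `A` through `ρ`. As `A` is discrete, continuous means
locally constant. -/
def contCocycles (ρ : G →* AddMonoid.End A) : AddSubgroup (G → A) where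
  carrier := {c | IsLocallyConstant c ∧ ∀ g h : G, c (g * h) = c g + ρ g (c h)}
  zero_mem' := ⟨IsLocallyConstant.const 0, fun g h => by simp⟩
  add_mem' := fun {c d} hc hd => ⟨hc.1.add hd.1, fun g h => by
    simp only [Pi.add_apply, hc.2 g h, hd.2 g h, map_add]; abel⟩
  neg_mem' := fun {c} hc => ⟨hc.1.neg, fun g h => by
    simp only [Pi.neg_apply, hc.2 g h, map_neg]; abel⟩

/-- The group `B¹(G, A)` of principal crossed homomorphisms `g ↦ g a - a`. -/
def principalCocycles (ρ : G →* AddMonoid.End A) : AddSubgroup (G → A) where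
  carrier := {c | ∃ a : A, ∀ g : G, c g = ρ g a - a}
  zero_mem' := ⟨0, fun g => by simp⟩
  add_mem' := by
    rintro c d ⟨a, ha⟩ ⟨b, hb⟩
    exact ⟨a + b, fun g => by simp only [Pi.add_apply, ha g, hb g, map_add]; abel⟩
  neg_mem' := by
    rintro c ⟨a, ha⟩
    exact ⟨-a, fun g => by simp only [Pi.neg_apply, ha g, map_neg]; abel⟩

/-- The first continuous cohomology group `H¹(G, A)` of `G` acting on the discrete group `A`:
continuous crossed homomorphisms modulo principal ones. -/
abbrev ContH1 (ρ : G →* AddMonoid.End A) : Type _ :=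
  contCocycles ρ ⧸ (principalCocycles ρ).addSubgroupOf (contCocycles ρ)

/-- A continuous homomorphism `φ : H → G` and an additive map `f : A → B` with
`f (φ(h) a) = h f(a)` send the cocycle `c` to the cocycle `f ∘ c ∘ φ`. -/
noncomputable def contCocyclesMap {ρ : G →* AddMonoid.End A} {τ : H →* AddMonoid.End B}
    (φ : H →ₜ* G) (f : A →+ B) (hf : ∀ (h : H) (a : A), f (ρ (φ h) a) = τ h (f a)) :
    contCocycles ρ →+ contCocycles τ where
  toFun c := ⟨fun h => f (c.1 (φ h)),
    (c.2.1.comp_continuous φ.continuous_toFun).comp f, fun g h => by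
      simp only [map_mul, c.2.2, map_add, hf]⟩
  map_zero' := by ext h; simp
  map_add' c d := by ext h; simp

/-- The homomorphism `H¹(G, A) → H¹(H, B)` induced by a compatible pair. -/
noncomputable def ContH1.map {ρ : G →* AddMonoid.End A} {τ : H →* AddMonoid.End B}
    (φ : H →ₜ* G) (f : A →+ B) (hf : ∀ (h : H) (a : A), f (ρ (φ h) a) = τ h (f a)) :
    ContH1 ρ →+ ContH1 τ :=
  QuotientAddGroup.map _ _ (contCocyclesMap φ f hf) (by
    rintro c ⟨a, ha⟩
    refine ⟨f a, fun h => ?_⟩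
    have := ha (φ h)
    simp only [AddSubgroup.coe_subtype] at this
    simp [contCocyclesMap, this, hf])

/-- The restriction map `H¹(N, A) → H¹(N', A)` for subgroups `N' ≤ N` of `G`. -/
noncomputable def ContH1.res (ρ : G →* AddMonoid.End A) {N N' : Subgroup G} (h : N' ≤ N) :
    ContH1 (ρ.comp N.subtype) →+ ContH1 (ρ.comp N'.subtype) :=
  ContH1.map ⟨Subgroup.inclusion h, continuous_inclusion h⟩ (AddMonoidHom.id A)
    (fun _ _ => rfl)

/-- The conjugation action of `s : G` on `H¹(N, A)` for a normal subgroup `N` of `G`: the class of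
`c` is sent to the class of `n ↦ s c(s⁻¹ n s)`. -/
noncomputable def ContH1.conj [IsTopologicalGroup G] (ρ : G →* AddMonoid.End A) (N : Subgroup G) [hN : N.Normal]
    (s : G) : ContH1 (ρ.comp N.subtype) →+ ContH1 (ρ.comp N.subtype) :=
  ContH1.map
    ⟨{  toFun := fun n => ⟨s⁻¹ * n * s, hN.conj_mem' n.1 n.2 s⟩
        map_one' := by ext; simp
        map_mul' := fun a b => by ext; simp [mul_assoc] }, by
      refine Continuous.subtype_mk ?_ _
      fun_prop⟩
    (ρ s) (fun n a => by
      change (ρ s) ((ρ (s⁻¹ * n * s)) a) = ρ n (ρ s a)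
      have h : ρ s * ρ (s⁻¹ * n * s) = ρ n * ρ s := by
        rw [← map_mul, ← map_mul]
        congr 1
        group
      exact DFunLike.congr_fun h a)

end Cohomology

/-! ### Points of elliptic curves as Galois modules -/

/-- The set `E(F)` of points of `E` over an extension `F` of `ℚ`. -/
noncomputable def EPoint (E : WeierstrassCurve ℚ) (F : Type*) [Field F] [Algebra ℚ F] : Type _ :=
  (E.baseChange F).toAffine.Point

noncomputable instance (E : WeierstrassCurve ℚ) (F : Type*) [Field F] [Algebra ℚ F] :
    AddCommGroup (EPoint E F) :=
  letI := Classical.decEq F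
  inferInstanceAs (AddCommGroup (E.baseChange F).toAffine.Point)

/-- The map `E(F) → E(K)` induced by a field embedding `F → K` over `ℚ`. -/
noncomputable def EPoint.map (E : WeierstrassCurve ℚ) {F K : Type*} [Field F] [Algebra ℚ F] [Field K]
    [Algebra ℚ K] (f : F →ₐ[ℚ] K) : EPoint E F →+ EPoint E K :=
  letI := Classical.decEq F
  letI := Classical.decEq K
  WeierstrassCurve.Affine.Point.map (W' := E.toAffine) f

lemma EPoint.map_map (E : WeierstrassCurve ℚ) {F K L : Type*} [Field F] [Algebra ℚ F] [Field K]
    [Algebra ℚ K] [Field L] [Algebra ℚ L] (f : F →ₐ[ℚ] K) (g : K →ₐ[ℚ] L) (P : EPoint E F) :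
    EPoint.map E g (EPoint.map E f P) = EPoint.map E (g.comp f) P  := by
  cases P <;> rfl

lemma EPoint.map_id (E : WeierstrassCurve ℚ) {F : Type*} [Field F] [Algebra ℚ F]
    (P : EPoint E F) : EPoint.map E (AlgHom.id ℚ F) P = P := by
  cases P <;> rfl

/-- The action of `Gal(F/k)` on `E(F)`, for an extension `F/k` of extensions of `ℚ`. -/
noncomputable def EPoint.galAction (E : WeierstrassCurve ℚ) (k F : Type*) [Field k] [Algebra ℚ k] [Field F]
    [Algebra ℚ F] [Algebra k F] [IsScalarTower ℚ k F] : Gal(F/k) →* AddMonoid.End (EPoint E F) where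
  toFun g := EPoint.map E (g.toAlgHom.restrictScalars ℚ)
  map_one' := by
    ext P
    exact EPoint.map_id E (F := F) P
  map_mul' g h := by
    ext P
    exact (EPoint.map_map E (h.toAlgHom.restrictScalars ℚ) (g.toAlgHom.restrictScalars ℚ) P).symm

/-- The `p`-primary subgroup `E(F)[p^∞]` of `E(F)`. -/
noncomputable abbrev EPrimary (E : WeierstrassCurve ℚ) (p : ℕ) (F : Type*) [Field F] [Algebra ℚ F] :
    AddSubgroup (EPoint E F) :=
  AddCommGroup.primaryComponent (EPoint E F) p

/-- The action of `Gal(F/ℚ)` on `E(F)[p^∞]`. -/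
noncomputable def EPrimary.galAction (E : WeierstrassCurve ℚ) (p : ℕ) (F : Type*) [Field F] [Algebra ℚ F] :
    Gal(F/ℚ) →* AddMonoid.End (EPrimary E p F) where
  toFun g :=
    { toFun := fun P => ⟨EPoint.galAction E ℚ F g P.1, by
        obtain ⟨k, hk⟩ := P.2
        exact ⟨k, by rw [← map_nsmul, hk, map_zero]⟩⟩
      map_zero' := by ext; simp
      map_add' := fun P Q => by ext; simp }
  map_one' := by
    ext P
    exact congrArg (fun f => f P.1) (map_one (EPoint.galAction E ℚ F))
  map_mul' g h := by
    ext P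
    exact congrArg (fun f => f P.1) (map_mul (EPoint.galAction E ℚ F) g h)

/-! ### Reduction types -/

/-- `E` has good reduction at the prime `l`: a minimal Weierstrass equation of `E` over `ℤ_l` has
unit discriminant. -/
noncomputable def HasGoodReductionAt (E : WeierstrassCurve ℚ) (l : ℕ) [Fact l.Prime] : Prop :=
  ((E.baseChange ℚ_[l]).minimal ℤ_[l]).HasGoodReduction ℤ_[l]

/-- The trace of Frobenius `a_l = l + 1 - #Ẽ(𝔽_l)`, where `Ẽ` is the reduction modulo `l` of a
minimal Weierstrass equation of `E` over `ℤ_l`. -/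
noncomputable def frobeniusTrace (E : WeierstrassCurve ℚ) (l : ℕ) [Fact l.Prime] : ℤ :=
  l + 1 - Nat.card (((E.baseChange ℚ_[l]).minimal ℤ_[l]).reduction ℤ_[l]).toAffine.Point

/-- `E` has good ordinary reduction at `p`: good reduction with `p ∤ a_p`. -/
noncomputable def HasGoodOrdinaryReductionAt (E : WeierstrassCurve ℚ) (p : ℕ) [Fact p.Prime] : Prop :=
  HasGoodReductionAt E p ∧ ¬ (p : ℤ) ∣ frobeniusTrace E p

/-! ### The fields -/

/-- A fixed algebraic closure of `ℚ`. -/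
abbrev QBar : Type := AlgebraicClosure ℚ

/-- All primes of the number field `K` above the rational prime `l` are unramified over `ℚ`. -/
noncomputable def IsUnramifiedAbove (K : IntermediateField ℚ QBar) (l : ℕ) : Prop :=
  ∀ (P : Ideal (𝓞 K)) [P.IsPrime], (l : 𝓞 K) ∈ P → Algebra.IsUnramifiedAt ℤ P

/-- The maximal extension `ℚ_S` of `ℚ` (inside `QBar`) in which all primes `l ∉ S` are unramified:
the compositum of all finite Galois extensions of `ℚ` unramified at all primes `l ∉ S`. -/
noncomputable def QMax (S : Finset Nat.Primes) : IntermediateField ℚ QBar :=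
  ⨆ K : {K : FiniteGaloisIntermediateField ℚ QBar //
    ∀ l : Nat.Primes, l ∉ S → IsUnramifiedAbove K.toIntermediateField l}, K.1.toIntermediateField

instance (S : Finset Nat.Primes) : Normal ℚ (QMax S) :=
  IntermediateField.normal_iSup (h := fun K => K.1.isGalois.to_normal)

/-- The field `ℚ(μ_{p^∞})` generated by all roots of unity of `p`-power order. -/
noncomputable def QMu (p : ℕ) : IntermediateField ℚ QBar :=
  IntermediateField.adjoin ℚ {z : QBar | ∃ n : ℕ, z ^ p ^ n = 1}

instance (p : ℕ) : Normal ℚ (QMu p) := by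
  rw [IntermediateField.normal_iff_forall_map_le]
  intro σ
  rw [QMu, IntermediateField.adjoin_map]
  apply IntermediateField.adjoin.mono
  rintro _ ⟨z, ⟨n, hn⟩, rfl⟩
  exact ⟨n, by rw [← map_pow, hn, map_one]⟩

instance (p : ℕ) : IsGalois ℚ (QMu p) where

/-- The cyclotomic `ℤ_p`-extension of `ℚ` as a subfield of `ℚ(μ_{p^∞})`: the fixed field of the
torsion subgroup of `Gal(ℚ(μ_{p^∞})/ℚ)`. (This group is isomorphic to `ℤ_pˣ`, its elements of finite
order form a subgroup, and the quotient by it is isomorphic to `ℤ_p` when `p` is odd.) -/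
noncomputable def QCycInMu (p : ℕ) : IntermediateField ℚ (QMu p) :=
  IntermediateField.fixedField (Subgroup.closure {σ : Gal(QMu p/ℚ) | IsOfFinOrder σ})

/-- The cyclotomic `ℤ_p`-extension `ℚ^cyc` of `ℚ`. -/
noncomputable def QCyc (p : ℕ) : IntermediateField ℚ QBar :=
  IntermediateField.lift (QCycInMu p)

lemma QCyc_le_QMu (p : ℕ) : QCyc p ≤ QMu p :=
  IntermediateField.lift_le _

/-- The group `Δ`, the kernel of the restriction `Gal(ℚ(μ_{p^∞})/ℚ) → Gal(ℚ^cyc/ℚ)`, that is, the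
subgroup of those automorphisms which are trivial on `ℚ^cyc`. -/
noncomputable def DeltaGroup (p : ℕ) : Subgroup Gal(QMu p/ℚ) :=
  (QCycInMu p).fixingSubgroup

/-! ### Selmer groups -/

section Selmer

/-- The group `G_S(L) = Gal(ℚ_S/L)`, as a subgroup of `Gal(ℚ_S/ℚ)`, for a subfield `L` of `ℚ_S`. -/
noncomputable def GalS (S : Finset Nat.Primes) (L : IntermediateField ℚ QBar) : Subgroup Gal(QMax S/ℚ) where
  carrier := {g | ∀ x : QMax S, (x : QBar) ∈ L → g x = x}
  one_mem' := fun _ _ => rfl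
  mul_mem' := fun {a b} ha hb x hx => by rw [AlgEquiv.mul_apply, hb x hx, ha x hx]
  inv_mem' := fun {a} ha x hx => by
    rw [AlgEquiv.aut_inv, AlgEquiv.symm_apply_eq, ha x hx]

lemma GalS_anti (S : Finset Nat.Primes) {L L' : IntermediateField ℚ QBar} (h : L ≤ L') :
    GalS S L' ≤ GalS S L :=
  fun _ hg x hx => hg x (h hx)

instance (S : Finset Nat.Primes) (L : IntermediateField ℚ QBar) [Normal ℚ L] :
    (GalS S L).Normal where
  conj_mem := by
    intro n hn g x hx
    have hx' : ((g⁻¹ x : QMax S) : QBar) ∈ L := by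
      have h1 := IntermediateField.normal_iff_forall_map_le'.mp
        (inferInstance : Normal ℚ L) (AlgEquiv.liftNormal g⁻¹ QBar)
      have h2 := AlgEquiv.liftNormal_commutes g⁻¹ QBar x
      have h3 : AlgEquiv.liftNormal g⁻¹ QBar (x : QBar) = ((g⁻¹ x : QMax S) : QBar) := h2
      rw [← h3]
      exact h1 ⟨x, hx, rfl⟩
    rw [AlgEquiv.mul_apply, AlgEquiv.mul_apply, hn _ hx', ← AlgEquiv.mul_apply, mul_inv_cancel,
      AlgEquiv.one_apply]

variable (E : WeierstrassCurve ℚ) (p : ℕ) (S : Finset Nat.Primes)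

/-- The Galois module `E_{p^∞}`, as a module over `Gal(ℚ_S/ℚ)`. When `S` contains `p` and all primes
of bad reduction of `E`, all `p`-power torsion points of `E` over `QBar` are defined over `ℚ_S`,
and this is all of `E_{p^∞}`. -/
noncomputable abbrev torsionModule : Gal(QMax S/ℚ) →* AddMonoid.End (EPrimary E p (QMax S)) :=
  EPrimary.galAction E p (QMax S)

/-- The group `H¹(G_S(L), E_{p^∞})`. -/
abbrev GlobalH1 (L : IntermediateField ℚ QBar) : Type :=
  ContH1 ((torsionModule E p S).comp (GalS S L).subtype)

variable (l : ℕ) [Fact l.Prime]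

/-- A fixed algebraic closure of `ℚ_l`. -/
abbrev QlBar : Type := AlgebraicClosure ℚ_[l]

variable {l}

/-- Let `w` be the prime of `L` above `l` that is defined by an embedding `σ : QBar → QlBar l`
(every prime of `L` above `l` is of this form). This is the field `L_w = ℚ_l · σ(L)`, i.e. the union
of the completions at `w` of the number fields contained in `L`. -/
noncomputable def localField (σ : QBar →ₐ[ℚ] QlBar l) (L : IntermediateField ℚ QBar) :
    IntermediateField ℚ_[l] (QlBar l) :=
  IntermediateField.adjoin ℚ_[l] (σ '' (L : Set QBar))

/-- The group `H¹(L_w, E) = H¹(Gal(QlBar l/L_w), E(QlBar l))`. -/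
abbrev LocalH1 (σ : QBar →ₐ[ℚ] QlBar l) (L : IntermediateField ℚ QBar) : Type :=
  ContH1 ((EPoint.galAction E ℚ_[l] (QlBar l)).comp (localField σ L).fixingSubgroup.subtype)

/-- The homomorphism `Gal(QlBar l/ℚ_l) → Gal(ℚ_S/ℚ)` defined by an embedding `σ`: it sends `τ` to the
unique `g` with `σ ∘ g = τ ∘ σ` on `ℚ_S`. -/
noncomputable def decomp (σ : QBar →ₐ[ℚ] QlBar l) : Gal(QlBar l/ℚ_[l]) →* Gal(QMax S/ℚ) :=
  letI := (σ.comp (QMax S).val).toRingHom.toAlgebra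
  haveI : IsScalarTower ℚ (QMax S) (QlBar l) :=
    IsScalarTower.of_algebraMap_eq' (Subsingleton.elim _ _)
  (AlgEquiv.restrictNormalHom (F := ℚ) (K₁ := QlBar l) (QMax S)).comp
    (AlgEquiv.restrictScalarsHom ℚ)

lemma decomp_spec (σ : QBar →ₐ[ℚ] QlBar l) (τ : Gal(QlBar l/ℚ_[l])) (x : QMax S) :
    σ (decomp S σ τ x : QMax S) = τ (σ x) := by
  let := (σ.comp (QMax S).val).toRingHom.toAlgebra
  have : IsScalarTower ℚ (QMax S) (QlBar l) :=
    IsScalarTower.of_algebraMap_eq' (Subsingleton.elim _ _)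
  exact AlgEquiv.restrictNormal_commutes (F := ℚ) (K₁ := QlBar l) (K₂ := QlBar l)
    (τ.restrictScalars ℚ) (QMax S) x

lemma decomp_continuous (σ : QBar →ₐ[ℚ] QlBar l) : Continuous (decomp S σ) := by
  apply continuous_of_continuousAt_one _ (continuousAt_def.mpr _)
  intro N hN
  rw [map_one, krullTopology_mem_nhds_one_iff] at hN
  obtain ⟨K, hK, hKN⟩ := hN
  obtain ⟨T, hT⟩ := IntermediateField.essFiniteType_iff.mp
    (inferInstance : Algebra.EssFiniteType ℚ K)
  let M : IntermediateField ℚ_[l] (QlBar l) :=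
    IntermediateField.adjoin ℚ_[l] ((fun x : QMax S => σ x) '' (T : Set (QMax S)))
  have hM : FiniteDimensional ℚ_[l] M :=
    IntermediateField.finiteDimensional_adjoin fun x _ => Algebra.IsIntegral.isIntegral x
  refine mem_nhds_iff.mpr ⟨M.fixingSubgroup, ?_, M.fixingSubgroup_isOpen, one_mem _⟩
  intro τ hτ
  apply hKN
  have hsub : K ≤ IntermediateField.fixedField (Subgroup.zpowers (decomp S σ τ)) := by
    rw [← hT, IntermediateField.adjoin_le_iff]
    intro x hx
    have hfix : decomp S σ τ x = x := by
      apply Subtype.val_injective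
      apply σ.toRingHom.injective
      change σ (decomp S σ τ x : QMax S) = σ x
      rw [decomp_spec]
      exact (IntermediateField.mem_fixingSubgroup_iff _ _).mp hτ _
        (IntermediateField.subset_adjoin _ _ ⟨x, hx, rfl⟩)
    rw [SetLike.mem_coe, IntermediateField.mem_fixedField_iff]
    intro f hf
    have : Subgroup.zpowers (decomp S σ τ) ≤ MulAction.stabilizer Gal(QMax S/ℚ) x := by
      rw [Subgroup.zpowers_le]
      exact hfix
    exact this hf
  rw [SetLike.mem_coe, IntermediateField.mem_fixingSubgroup_iff]
  intro x hx
  exact (IntermediateField.mem_fixedField_iff _ _).mp (hsub hx) _ (Subgroup.mem_zpowers _)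

/-- The homomorphism `Gal(QlBar l/L_w) → G_S(L)` defined by an embedding `σ`. -/
noncomputable def localToGlobal (σ : QBar →ₐ[ℚ] QlBar l) (L : IntermediateField ℚ QBar) :
    (localField σ L).fixingSubgroup →ₜ* GalS S L where
  toFun τ := ⟨decomp S σ τ.1, fun x hx => by
    apply Subtype.val_injective
    apply σ.toRingHom.injective
    change σ (decomp S σ τ.1 x : QMax S) = σ x
    rw [decomp_spec]
    exact (IntermediateField.mem_fixingSubgroup_iff _ _).mp τ.2 _
      (IntermediateField.subset_adjoin _ _ ⟨x, hx, rfl⟩)⟩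
  map_one' := by ext1; exact map_one (decomp S σ)
  map_mul' a b := by ext1; exact map_mul (decomp S σ) a.1 b.1
  continuous_toFun :=
    Continuous.subtype_mk ((decomp_continuous S σ).comp continuous_subtype_val) _

/-- The inclusion `E_{p^∞} → E(QlBar l)` defined by an embedding `σ`. -/
noncomputable def torsionToLocal (σ : QBar →ₐ[ℚ] QlBar l) : EPrimary E p (QMax S) →+ EPoint E (QlBar l) :=
  (EPoint.map E (σ.comp (QMax S).val)).comp (EPrimary E p (QMax S)).subtype

/-- The localization map `H¹(G_S(L), E_{p^∞}) → H¹(L_w, E)` at the prime `w` of `L` defined by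
the embedding `σ`. -/
noncomputable def localization (σ : QBar →ₐ[ℚ] QlBar l) (L : IntermediateField ℚ QBar) :
    GlobalH1 E p S L →+ LocalH1 E σ L :=
  ContH1.map (localToGlobal S σ L) (torsionToLocal E p S σ) (fun τ P => by
    change EPoint.map E (σ.comp (QMax S).val) (EPoint.map E _ P.1) =
      EPoint.map E _ (EPoint.map E (σ.comp (QMax S).val) P.1)
    rw [EPoint.map_map, EPoint.map_map]
    have h : (σ.comp (QMax S).val).comp
        ((decomp S σ τ.1).toAlgHom.restrictScalars ℚ) =
        (τ.1.toAlgHom.restrictScalars ℚ).comp (σ.comp (QMax S).val) :=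
      AlgHom.ext fun x => decomp_spec S σ τ.1 x
    exact congrArg (fun f => EPoint.map E f P.1) h)

/-- The localization map
`λ_S(L) : H¹(G_S(L), E_{p^∞}) → ∏_{l ∈ S} ∏_{w ∣ l} H¹(L_w, E)`, where the primes `w` of `L` above
`l` are given by the embeddings `σ : QBar → QlBar l`. (Embeddings that define the same prime `w`
are conjugate over `L`, so that they impose the same condition. The source is a
`p`-primary group, and so the image lies in the `p`-primary parts `H¹(L_w, E)_{p^∞}`.) -/
noncomputable def localizationMap (L : IntermediateField ℚ QBar) :
    GlobalH1 E p S L →+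
      ((l : {l : Nat.Primes // l ∈ S}) →
        haveI : Fact (l.1 : ℕ).Prime := ⟨l.1.2⟩
        (σ : QBar →ₐ[ℚ] QlBar l.1) → LocalH1 E σ L) :=
  AddMonoidHom.pi fun l =>
    haveI : Fact (l.1 : ℕ).Prime := ⟨l.1.2⟩
    AddMonoidHom.pi fun σ => localization E p S σ L

/-- The `p`-primary Selmer group `Sel(E/L) = ker λ_S(L)`. -/
noncomputable def Selmer (L : IntermediateField ℚ QBar) : AddSubgroup (GlobalH1 E p S L) :=
  (localizationMap E p S L).ker

/-- The restriction map `H¹(G_S(ℚ^cyc), E_{p^∞}) → H¹(G_S(ℚ(μ_{p^∞})), E_{p^∞})`. -/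
noncomputable def restriction : GlobalH1 E p S (QCyc p) →+ GlobalH1 E p S (QMu p) :=
  ContH1.res (torsionModule E p S) (GalS_anti S (QCyc_le_QMu p))

/-- The subgroup `Sel(E/ℚ(μ_{p^∞}))^Δ` of the Selmer group. An element of `Δ` acts on
`H¹(G_S(ℚ(μ_{p^∞})), E_{p^∞})` as the conjugation by any of its extensions to an automorphism `s` of
`QBar`. -/
noncomputable def SelmerMuDelta : AddSubgroup (GlobalH1 E p S (QMu p)) where
  carrier := {c | c ∈ Selmer E p S (QMu p) ∧
    ∀ s : Gal(QBar/ℚ), AlgEquiv.restrictNormalHom (QMu p) s ∈ DeltaGroup p →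
      ContH1.conj (torsionModule E p S) (GalS S (QMu p))
        (AlgEquiv.restrictNormalHom (QMax S) s) c = c}
  zero_mem' := ⟨zero_mem _, fun _ _ => map_zero _⟩
  add_mem' := fun {a b} ha hb => ⟨add_mem ha.1 hb.1, fun s hs => by
    rw [map_add, ha.2 s hs, hb.2 s hs]⟩
  neg_mem' := fun {a} ha => ⟨neg_mem ha.1, fun s hs => by rw [map_neg, ha.2 s hs]⟩

end Selmer

/-! The order of `Δ` is prime to `p`, while the global cohomology groups are `p`-primary, so passing
between `ℚ^cyc` and `ℚ(μ_{p^∞})` loses nothing.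

The cyclotomic character embeds the torsion of `Gal(ℚ(μ_{p^∞})/ℚ)` into the torsion of `ℤ_pˣ`, which
for odd `p` injects into `(ℤ/p)ˣ`; hence `DeltaGroup.card_dvd`. For subgroups `N ≤ M` of finite
index `m`, averaging over cosets gives two facts: `m` kills the kernel of `H¹(M, A) → H¹(N, A)`
(`ContH1.relIndex_nsmul_eq_zero`), and, for `N` normal and open in `M`, `m` times an invariant class
is a restriction (`ContH1.exists_res_eq_relIndex_nsmul`). When `m` divides `#Δ`, it is invertible on
`p`-primary classes, so global restriction is injective and hits every invariant Selmer class.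

The Selmer conditions match because localization commutes with restriction and the local relative
indices also divide `#Δ`: a local class that dies over `ℚ(μ_{p^∞})` is killed by an integer prime to
`p` and, coming from a global class, by a power of `p`. -/

/-! ### The group `Δ` -/

/-- For odd `p`, the only `p`-adic integer of finite multiplicative order congruent to `1` modulo
`p` is `1`. -/
lemma PadicInt.eq_one_of_isOfFinOrder {p : ℕ} [hp : Fact p.Prime] (hodd : Odd p) {u : ℤ_[p]}
    (hu : IsOfFinOrder u) (h1 : (p : ℤ_[p]) ∣ u - 1) : u = 1 := by
  by_contra hne
  have hpp : Prime (p : ℤ_[p]) := PadicInt.prime_p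
  obtain ⟨n, hn, hun⟩ := isOfFinOrder_iff_pow_eq_one.mp hu
  obtain ⟨a, k, hk, rfl⟩ := Nat.exists_eq_pow_mul_and_not_dvd hn.ne' p hp.out.ne_one
  have hnu : ¬ (p : ℤ_[p]) ∣ u := fun h => hpp.not_isUnit
    (isUnit_of_dvd_one (by simpa using dvd_sub h h1))
  have hv : (p : ℤ_[p]) ∣ u ^ p ^ a - 1 :=
    h1.trans (by simpa using sub_dvd_pow_sub_pow u 1 (p ^ a))
  have hk' : ¬ (p : ℤ_[p]) ∣ (k : ℤ_[p]) := by
    intro h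
    rw [← PadicInt.norm_lt_one_iff_dvd, ← Int.cast_natCast, PadicInt.norm_intCast_lt_one_iff] at h
    exact hk (by exact_mod_cast h)
  -- Lifting the exponent: with `n = p^a k` and `p ∤ k`, `v(u^n - 1) = v(u^(p^a) - 1) = v(u - 1) +
  -- a`. The left side is infinite as `u^n = 1`, the right side finite as `u ≠ 1`.
  have e1 := emultiplicity_pow_sub_pow_of_prime (y := 1) hpp (by simpa using hv)
    (fun h => hnu (hpp.dvd_of_dvd_pow h)) hk'
  have e2 := emultiplicity_pow_prime_pow_sub_pow_prime_pow (y := 1) hpp hodd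
    (by simpa using h1) hnu a
  rw [one_pow] at e2
  rw [e2, ← pow_mul, hun, one_pow, sub_self, emultiplicity_zero] at e1
  have hf : FiniteMultiplicity (p : ℤ_[p]) (u - 1) :=
    FiniteMultiplicity.of_prime_left hpp (sub_ne_zero.mpr hne)
  rw [hf.emultiplicity_eq_multiplicity] at e1
  exact ENat.natCast_ne_top _ (by exact_mod_cast e1.symm)

/-- For odd `p`, the torsion subgroup of `ℤ_pˣ` embeds into `(ℤ/p)ˣ`. -/
lemma PadicInt.torsion_toZMod_injective {p : ℕ} [Fact p.Prime] (hodd : Odd p) :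
    Function.Injective ((Units.map (PadicInt.toZMod (p := p)).toMonoidHom).comp
      (CommGroup.torsion ℤ_[p]ˣ).subtype) := by
  rw [injective_iff_map_eq_one]
  rintro ⟨u, hu⟩ h
  have h' : PadicInt.toZMod (u : ℤ_[p]) = 1 := congrArg Units.val h
  ext
  refine PadicInt.eq_one_of_isOfFinOrder hodd (Units.isOfFinOrder_val.mpr hu) ?_
  rw [← Ideal.mem_span_singleton, ← PadicInt.maximalIdeal_eq_span_p, ← PadicInt.ker_toZMod,
    RingHom.mem_ker, map_sub, h', map_one, sub_self]

/-- Needed for the cyclotomic character to describe the action on roots of unity in `QMu p`. -/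
instance QMu.hasEnoughRootsOfUnity (p : ℕ) [Fact p.Prime] (i : ℕ) :
    HasEnoughRootsOfUnity (QMu p) (p ^ i) where
  prim := by
    have : NeZero ((p ^ i : ℕ) : QBar) := ⟨by
      exact_mod_cast pow_ne_zero _ (Fact.out : p.Prime).ne_zero⟩
    obtain ⟨z, hz⟩ := HasEnoughRootsOfUnity.exists_primitiveRoot QBar (p ^ i)
    refine ⟨⟨z, IntermediateField.subset_adjoin _ _ ⟨i, hz.pow_eq_one⟩⟩, ?_⟩
    exact IsPrimitiveRoot.of_map_of_injective (f := (QMu p).val) hz (QMu p).val.injective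
  cyc := rootsOfUnity.isCyclic _ _

/-- The cyclotomic character `Gal(ℚ(μ_{p^∞})/ℚ) → ℤ_pˣ`. -/
noncomputable def QMu.cycloChar (p : ℕ) [Fact p.Prime] : Gal(QMu p/ℚ) →* ℤ_[p]ˣ :=
  (cyclotomicCharacter (QMu p) p).comp
    { toFun := fun g => g.toRingEquiv
      map_one' := rfl
      map_mul' := fun _ _ => rfl }

/-- The roots of unity of `p`-power order generate the field, and an automorphism with trivial
character fixes each of them. -/
lemma QMu.cycloChar_injective (p : ℕ) [Fact p.Prime] :
    Function.Injective (QMu.cycloChar p) := by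
  rw [injective_iff_map_eq_one]
  intro g hg
  have key : ∀ x : QBar, (hx : x ∈ QMu p) → g ⟨x, hx⟩ = ⟨x, hx⟩ := by
    intro x hx
    induction hx using IntermediateField.adjoin_induction with
    | mem z hz =>
      obtain ⟨n, hn⟩ := hz
      have hmem : z ∈ QMu p := IntermediateField.subset_adjoin _ _ ⟨n, hn⟩
      have h := cyclotomicCharacter.spec p (n := n) (L := QMu p) g.toRingEquiv ⟨z, hmem⟩
        (Subtype.ext hn)
      have h1 : cyclotomicCharacter (QMu p) p g.toRingEquiv = 1 := hg
      rw [h1, Units.val_one, map_one] at h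
      refine h.trans ?_
      -- The case `n = 0` is separate because the representative of `1` in `ZMod 1` is `0`, not `1`.
      rcases n with _ | n
      · have hz1 : (⟨z, hmem⟩ : QMu p) = 1 := Subtype.ext (by simpa using hn)
        rw [hz1, one_pow]
      · have : Fact (1 < p ^ (n + 1)) :=
          ⟨Nat.one_lt_pow n.succ_ne_zero (Fact.out : p.Prime).one_lt⟩
        rw [ZMod.val_one, pow_one]
    | algebraMap q => exact g.commutes q
    | add x y hx hy h1 h2 =>
      exact (map_add g ⟨x, hx⟩ ⟨y, hy⟩).trans (congrArg₂ (· + ·) h1 h2)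
    | inv x hx h1 => exact (map_inv₀ g ⟨x, hx⟩).trans (congrArg (·⁻¹) h1)
    | mul x y hx hy h1 h2 =>
      exact (map_mul g ⟨x, hx⟩ ⟨y, hy⟩).trans (congrArg₂ (· * ·) h1 h2)
  ext x
  exact congrArg Subtype.val (key x x.2)

/-- The closed subgroup of a Galois group generated by a finite subgroup is the subgroup itself. -/
lemma InfiniteGalois.fixingSubgroup_fixedField_of_finite {k K : Type*} [Field k] [Field K]
    [Algebra k K] [IsGalois k K] (H : Subgroup Gal(K/k)) [hH : Finite H] :
    (IntermediateField.fixedField H).fixingSubgroup = H :=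
  InfiniteGalois.fixingSubgroup_fixedField
    ⟨H, (Set.toFinite (H : Set Gal(K/k))).isClosed⟩

/-- For odd `p`, the group `Δ` is finite of order dividing `p - 1`. -/
lemma DeltaGroup.card_dvd (p : ℕ) [hp : Fact p.Prime] (hodd : Odd p) :
    Nat.card (DeltaGroup p) ∣ p - 1 := by
  set T : Subgroup Gal(QMu p/ℚ) := Subgroup.closure {σ | IsOfFinOrder σ} with hT
  have hle : T ≤ (CommGroup.torsion ℤ_[p]ˣ).comap (QMu.cycloChar p) :=
    (Subgroup.closure_le _).mpr fun σ hσ => MonoidHom.isOfFinOrder _ hσ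
  let f : T →* (ZMod p)ˣ := ((Units.map (PadicInt.toZMod (p := p)).toMonoidHom).comp
      (CommGroup.torsion ℤ_[p]ˣ).subtype).comp
        (((QMu.cycloChar p).comp T.subtype).codRestrict _ fun t => hle t.2)
  have hf : Function.Injective f :=
    (PadicInt.torsion_toZMod_injective hodd).comp fun a b h =>
      Subtype.ext (QMu.cycloChar_injective p (congrArg Subtype.val h))
  have : Finite T := Finite.of_injective f hf
  -- A priori `Δ` is only the closure of `T`; finiteness makes `T` closed.
  have hD : DeltaGroup p = T := InfiniteGalois.fixingSubgroup_fixedField_of_finite T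
  rw [hD, ← ZMod.card_units p, ← Nat.card_eq_fintype_card]
  exact Subgroup.card_dvd_of_injective f hf

lemma DeltaGroup.card_coprime (p : ℕ) [hp : Fact p.Prime] (hodd : Odd p) :
    (Nat.card (DeltaGroup p)).Coprime p := by
  refine Nat.Coprime.coprime_dvd_left (DeltaGroup.card_dvd p hodd) ?_
  have h := hp.out.two_le
  exact (Nat.coprime_of_lt_prime (by omega) (by omega) hp.out).symm

lemma DeltaGroup.card_ne_zero (p : ℕ) [hp : Fact p.Prime] (hodd : Odd p) :
    Nat.card (DeltaGroup p) ≠ 0 := by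
  intro h
  have h1 := DeltaGroup.card_coprime p hodd
  rw [h, Nat.coprime_zero_left] at h1
  exact hp.out.ne_one h1

/-! ### Restriction to a subgroup of finite index -/

section FiniteIndex

variable {G A : Type*} [Group G] [TopologicalSpace G] [AddCommGroup A]

lemma ContH1.mk_eq_zero_iff {ρ : G →* AddMonoid.End A} (c : contCocycles ρ) :
    (QuotientAddGroup.mk c : ContH1 ρ) = 0 ↔ ∃ a : A, ∀ g, c.1 g = ρ g a - a :=
  QuotientAddGroup.eq_zero_iff c

lemma ContH1.mk_eq_mk_iff {ρ : G →* AddMonoid.End A} (c d : contCocycles ρ) :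
    (QuotientAddGroup.mk c : ContH1 ρ) = QuotientAddGroup.mk d ↔
      ∃ a : A, ∀ g, c.1 g = d.1 g + (ρ g a - a) := by
  rw [← sub_eq_zero]
  refine (ContH1.mk_eq_zero_iff (c - d)).trans ?_
  refine exists_congr fun a => forall_congr' fun g => ?_
  change c.1 g - d.1 g = _ ↔ _
  rw [sub_eq_iff_eq_add']

lemma ContH1.res_mk_eq_mk_iff (ρ : G →* AddMonoid.End A) {N M : Subgroup G} (h : N ≤ M)
    (c : contCocycles (ρ.comp M.subtype)) (d : contCocycles (ρ.comp N.subtype)) :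
    ContH1.res ρ h (QuotientAddGroup.mk c) = QuotientAddGroup.mk d ↔
      ∃ a : A, ∀ n : N, c.1 ⟨n, h n.2⟩ = d.1 n + (ρ n a - a) :=
  ContH1.mk_eq_mk_iff (contCocyclesMap _ _ _ c) d

/-- A class in `H¹(M, A)` that vanishes on a subgroup `N` of finite index is killed by the index. -/
theorem ContH1.relIndex_nsmul_eq_zero (ρ : G →* AddMonoid.End A) {N M : Subgroup G} (h : N ≤ M)
    [Finite (M ⧸ N.subgroupOf M)] (x : ContH1 (ρ.comp M.subtype))
    (hx : ContH1.res ρ h x = 0) : N.relIndex M • x = 0 := by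
  obtain ⟨c, rfl⟩ := QuotientAddGroup.mk_surjective x
  obtain ⟨a, ha⟩ := (ContH1.mk_eq_zero_iff (contCocyclesMap _ _ _ c)).mp hx
  replace ha : ∀ n : N, c.1 ⟨n, h n.2⟩ = ρ n a - a := ha
  have hc : ∀ g k : M, c.1 (g * k) = c.1 g + ρ g (c.1 k) := c.2.2
  have hmul : ∀ (g k : G) (a : A), ρ (g * k) a = ρ g (ρ k a) := fun g k a => by
    rw [map_mul]; rfl
  have := Fintype.ofFinite (M ⧸ N.subgroupOf M)
  -- Subtracting the coboundary of `a` from `c` gives a cocycle vanishing on `N`, hence constant on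
  -- the cosets `mN`.
  let F : M ⧸ N.subgroupOf M → A :=
    Quotient.lift (fun m : M => c.1 m - (ρ m a - a)) (by
      intro m m' hmm
      have hn : (m⁻¹ * m') ∈ N.subgroupOf M := QuotientGroup.leftRel_apply.mp hmm
      obtain ⟨n, hmn⟩ : ∃ n : N, m' = m * ⟨n, h n.2⟩ := ⟨⟨_, hn⟩, by ext; simp⟩
      change c.1 m - _ = c.1 m' - _
      rw [hmn, hc, ha, Subgroup.coe_mul, hmul]
      simp only [map_sub]
      abel)
  have hF : ∀ m : M, F (QuotientGroup.mk m) = c.1 m - (ρ m a - a) := fun _ => rfl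
  have hg : ∀ (g : M) (q : M ⧸ N.subgroupOf M),
      ρ g (F q) = F (g • q) - (c.1 g - (ρ g a - a)) := by
    intro g q
    obtain ⟨m, rfl⟩ := QuotientGroup.mk_surjective q
    rw [MulAction.Quotient.smul_mk, smul_eq_mul, hF, hF, hc, Subgroup.coe_mul, hmul]
    simp only [map_sub]
    abel
  have hsum : ∀ g : M, ρ g (∑ q, F q) = ∑ q, F q - N.relIndex M • (c.1 g - (ρ g a - a)) := by
    intro g
    rw [map_sum]
    simp only [hg]
    rw [Finset.sum_sub_distrib, Finset.sum_const, Finset.card_univ, ← Nat.card_eq_fintype_card]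
    congr 1
    exact Fintype.sum_bijective _ (MulAction.bijective g) _ _ fun _ => rfl
  -- Summing the cocycle relation over cosets, `hsum` exhibits the index times the adjusted cocycle
  -- as the coboundary of `-∑ F`; the other term restores the coboundary of `a`.
  refine (ContH1.mk_eq_zero_iff (N.relIndex M • c)).mpr ⟨N.relIndex M • a - ∑ q, F q, ?_⟩
  intro g
  change N.relIndex M • c.1 g = ρ g _ - _
  rw [map_sub, map_nsmul, hsum]
  simp only [nsmul_sub]
  abel

/-- A crossed homomorphism that is locally constant on an open subgroup is locally constant. -/
lemma isLocallyConstant_of_isOpen_subgroup [IsTopologicalGroup G] (ρ : G →* AddMonoid.End A)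
    (d : G → A) (hd : ∀ g h, d (g * h) = d g + ρ g (d h)) (U : Subgroup G)
    (hU : IsOpen (U : Set G)) (hlc : IsLocallyConstant fun u : U => d u) :
    IsLocallyConstant d := by
  rw [IsLocallyConstant.iff_exists_open]
  intro g
  have h1 : d 1 = 0 := by simpa using hd 1 1
  -- The neighbourhood is `g · {u ∈ U | d u = 0}`, since `d (g u) = d g + g (d u)`.
  refine ⟨(fun k => g⁻¹ * k) ⁻¹' (Subtype.val '' {u : U | d u = 0}), ?_, ?_, ?_⟩
  · exact (hU.isOpenMap_subtype_val _ (hlc.isOpen_fiber 0)).preimage (by fun_prop)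
  · exact ⟨1, h1, by simp⟩
  · rintro k ⟨u, hu, huk⟩
    have hk : k = g * u := by simp [huk]
    have hu' : d u = 0 := hu
    rw [hk, hd, hu', map_zero, add_zero]

lemma IsLocallyConstant.finset_sum {X ι : Type*} [TopologicalSpace X] (T : Finset ι)
    (f : ι → X → A) (hf : ∀ i, IsLocallyConstant (f i)) :
    IsLocallyConstant fun x => ∑ i ∈ T, f i x := by
  classical
  induction T using Finset.induction_on with
  | empty => exact IsLocallyConstant.const 0
  | insert i T hi ih =>
    simp only [Finset.sum_insert hi]
    exact (hf i).add ih

/-- Corestriction: if a class `x` in `H¹(N, A)` is invariant under the action of `M / N`, then its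
multiple by the index of `N` in `M` is the restriction of a class in `H¹(M, A)`. -/
theorem ContH1.exists_res_eq_relIndex_nsmul [IsTopologicalGroup G] (ρ : G →* AddMonoid.End A)
    {N M : Subgroup G} (h : N ≤ M) [hN : N.Normal] [Finite (M ⧸ N.subgroupOf M)]
    (hopen : IsOpen (N.subgroupOf M : Set M)) (x : ContH1 (ρ.comp N.subtype))
    (hx : ∀ s ∈ M, ContH1.conj ρ N s x = x) :
    ∃ y : ContH1 (ρ.comp M.subtype), ContH1.res ρ h y = N.relIndex M • x := by
  classical
  obtain ⟨c, rfl⟩ := QuotientAddGroup.mk_surjective x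
  have := Fintype.ofFinite (M ⧸ N.subgroupOf M)
  have hmul : ∀ (g k : G) (a : A), ρ (g * k) a = ρ g (ρ k a) := fun g k a => by
    rw [map_mul]; rfl
  -- The value outside `N` is never used; extending by zero keeps membership proofs out of the
  -- formulas.
  let c' : G → A := fun g => if hg : g ∈ N then c.1 ⟨g, hg⟩ else 0
  have hc' : ∀ g (hg : g ∈ N), c' g = c.1 ⟨g, hg⟩ := fun g hg => dif_pos hg
  have hc : ∀ g ∈ N, ∀ k ∈ N, c' (g * k) = c' g + ρ g (c' k) := by
    intro g hg k hk
    rw [hc' _ hg, hc' _ hk, hc' _ (mul_mem hg hk)]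
    exact c.2.2 ⟨g, hg⟩ ⟨k, hk⟩
  have hconj : ∀ s ∈ M, ∃ a : A, ∀ n ∈ N, ρ s (c' (s⁻¹ * n * s)) = c' n + (ρ n a - a) := by
    intro s hs
    obtain ⟨a, ha⟩ := (ContH1.mk_eq_mk_iff (contCocyclesMap _ _ _ c) c).mp (hx s hs)
    refine ⟨a, fun n hn => ?_⟩
    rw [hc' n hn, hc' _ (hN.conj_mem' n hn s)]
    exact ha ⟨n, hn⟩
  obtain ⟨t, htM, ht⟩ : ∃ t : M ⧸ N.subgroupOf M → G, ∃ htM : ∀ q, t q ∈ M,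
      ∀ q, (QuotientGroup.mk ⟨t q, htM q⟩ : M ⧸ N.subgroupOf M) = q :=
    ⟨fun q => (Quotient.out q : M), fun q => (Quotient.out q : M).2, Quotient.out_eq⟩
  have hmem : ∀ (g : M) (q), (t (g • q))⁻¹ * g * t q ∈ N := by
    intro g q
    have h1 : (QuotientGroup.mk ⟨t (g • q), htM _⟩ : M ⧸ N.subgroupOf M) =
        QuotientGroup.mk (g * ⟨t q, htM q⟩) := by
      rw [ht, ← smul_eq_mul, ← MulAction.Quotient.smul_mk, ht]
    have h2 := QuotientGroup.eq.mp h1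
    rw [Subgroup.mem_subgroupOf] at h2
    simpa [mul_assoc] using h2
  -- The transfer formula for corestriction, relative to the transversal `t`.
  let d : M → A := fun g => ∑ q, ρ (t (g • q)) (c' ((t (g • q))⁻¹ * g * t q))
  have hd : ∀ g k : M, d (g * k) = d g + ρ g (d k) := by
    intro g k
    have h1 : d g = ∑ q, ρ (t (g • k • q)) (c' ((t (g • k • q))⁻¹ * g * t (k • q))) :=
      -- Reindexing by `q ↦ k • q` makes the inner factors compose, so the cocycle law of `c`
      -- applies term by term.
      (Fintype.sum_bijective _ (MulAction.bijective k) _ _ fun _ => rfl).symm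
    rw [h1, map_sum, ← Finset.sum_add_distrib]
    refine Finset.sum_congr rfl fun q _ => ?_
    have h2 : (t ((g * k) • q))⁻¹ * (g * k : M) * t q =
        ((t (g • k • q))⁻¹ * g * t (k • q)) * ((t (k • q))⁻¹ * k * t q) := by
      rw [mul_smul, Subgroup.coe_mul]; group
    rw [h2, hc _ (hmem g (k • q)) _ (hmem k q), map_add, mul_smul, ← hmul, ← hmul]
    congr 3
    group
  have hdN : ∀ n (hn : n ∈ N), d ⟨n, h hn⟩ = ∑ q, ρ (t q) (c' ((t q)⁻¹ * n * t q)) := by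
    intro n hn
    have hq : ∀ q : M ⧸ N.subgroupOf M, (⟨n, h hn⟩ : M) • q = q := by
      intro q
      obtain ⟨m, rfl⟩ := QuotientGroup.mk_surjective q
      rw [MulAction.Quotient.smul_mk, smul_eq_mul]
      refine (QuotientGroup.eq.mpr ?_).symm
      rw [Subgroup.mem_subgroupOf]
      simpa [mul_assoc] using hN.conj_mem' n hn m
    refine Finset.sum_congr rfl fun q _ => ?_
    rw [hq]
  -- On `N` every coset is fixed, so `d` is a sum of conjugates of `c`; by invariance the conjugate
  -- by `t q` is `c` plus the coboundary of `b q`.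
  choose b hb using fun q => hconj (t q) (htM q)
  have hdN' : ∀ n (hn : n ∈ N),
      d ⟨n, h hn⟩ = N.relIndex M • c' n + (ρ n (∑ q, b q) - ∑ q, b q) := by
    intro n hn
    rw [hdN n hn, Finset.sum_congr rfl fun q _ => hb q n hn, Finset.sum_add_distrib,
      Finset.sum_sub_distrib, Finset.sum_const, Finset.card_univ, ← Nat.card_eq_fintype_card,
      map_sum]
    rfl
  have hlcN : IsLocallyConstant fun u : N.subgroupOf M => d u := by
    have hterm : ∀ s : G, IsLocallyConstant fun u : N => ρ s (c' (s⁻¹ * u * s)) := by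
      intro s
      have hcont : Continuous fun u : N => (⟨s⁻¹ * u * s, hN.conj_mem' u u.2 s⟩ : N) :=
        Continuous.subtype_mk (by fun_prop) _
      have hs : (fun u : N => ρ s (c' (s⁻¹ * u * s))) =
          ρ s ∘ c.1 ∘ fun u : N => (⟨s⁻¹ * u * s, hN.conj_mem' u u.2 s⟩ : N) :=
        funext fun u => congrArg (ρ s) (hc' _ (hN.conj_mem' u u.2 s))
      rw [hs]
      exact (c.2.1.comp_continuous hcont).comp (ρ s)
    have hact : IsLocallyConstant fun u : N => d ⟨u, h u.2⟩ := by
      rw [funext fun u : N => hdN u u.2]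
      exact IsLocallyConstant.finset_sum _ _ fun q => hterm (t q)
    have hcont : Continuous fun u : N.subgroupOf M => (⟨u, u.2⟩ : N) :=
      Continuous.subtype_mk (by fun_prop) _
    have hcomp := hact.comp_continuous hcont
    exact hcomp
  let D : contCocycles (ρ.comp M.subtype) :=
    ⟨d, isLocallyConstant_of_isOpen_subgroup (ρ.comp M.subtype) d hd _ hopen hlcN, hd⟩
  refine ⟨QuotientAddGroup.mk D, ?_⟩
  rw [← QuotientAddGroup.mk_nsmul, ContH1.res_mk_eq_mk_iff]
  refine ⟨∑ q, b q, fun n => (hdN' n n.2).trans ?_⟩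
  rw [hc' _ n.2]
  rfl

/-- Elements of `M` act trivially on the image of `H¹(M, A)` in `H¹(N, A)`. -/
lemma ContH1.conj_res [IsTopologicalGroup G] (ρ : G →* AddMonoid.End A)
    {N M : Subgroup G} (h : N ≤ M) [hN : N.Normal] (y : ContH1 (ρ.comp M.subtype)) {s : G}
    (hs : s ∈ M) : ContH1.conj ρ N s (ContH1.res ρ h y) = ContH1.res ρ h y := by
  obtain ⟨c, rfl⟩ := QuotientAddGroup.mk_surjective y
  have hc : ∀ g k : M, c.1 (g * k) = c.1 g + ρ g (c.1 k) := c.2.2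
  refine (ContH1.mk_eq_mk_iff (contCocyclesMap _ _ _ (contCocyclesMap _ _ _ c))
    (contCocyclesMap _ _ _ c)).mpr ⟨c.1 ⟨s, hs⟩, fun n => ?_⟩
  change ρ s (c.1 ⟨s⁻¹ * n * s, _⟩) = c.1 ⟨n, h n.2⟩ + (ρ n (c.1 ⟨s, hs⟩) - c.1 ⟨s, hs⟩)
  -- Expanding `c` on both sides of `s · (s⁻¹ n s) = n · s` shows that the difference is the
  -- coboundary of `c s`.
  have h1 := hc ⟨s, hs⟩ ⟨s⁻¹ * n * s, h (hN.conj_mem' n.1 n.2 s)⟩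
  have h2 := hc ⟨n, h n.2⟩ ⟨s, hs⟩
  have h3 : (⟨s, hs⟩ : M) * ⟨s⁻¹ * n * s, h (hN.conj_mem' n.1 n.2 s)⟩ =
      ⟨n, h n.2⟩ * ⟨s, hs⟩ := by
    ext; simp [mul_assoc]
  rw [h3, h2] at h1
  change _ = _ + ρ s _ at h1
  rw [← sub_eq_iff_eq_add'] at h1
  rw [← h1, add_sub_assoc]

/-- For compact `G`, the group `H¹(G, A)` is `p`-primary when `A` is. -/
lemma ContH1.exists_pow_nsmul_eq_zero [CompactSpace G] {ρ : G →* AddMonoid.End A} (p : ℕ)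
    (hA : ∀ a : A, ∃ k : ℕ, p ^ k • a = 0) (x : ContH1 ρ) : ∃ k : ℕ, p ^ k • x = 0 := by
  obtain ⟨c, rfl⟩ := QuotientAddGroup.mk_surjective x
  choose k hk using hA
  -- Compactness leaves finitely many values, so the sum of their exponents works for all of them.
  have hfin : (Set.range c.1).Finite := c.2.1.range_finite
  refine ⟨∑ a ∈ hfin.toFinset, k a,
    (ContH1.mk_eq_zero_iff (p ^ (∑ a ∈ hfin.toFinset, k a) • c)).mpr ⟨0, fun g => ?_⟩⟩
  change p ^ (∑ a ∈ hfin.toFinset, k a) • c.1 g = _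
  have hle : k (c.1 g) ≤ ∑ a ∈ hfin.toFinset, k a :=
    Finset.single_le_sum (f := k) (fun _ _ => Nat.zero_le _) (by simp)
  rw [← Nat.sub_add_cancel hle, pow_add, mul_smul, hk, smul_zero, map_zero, sub_zero]

end FiniteIndex

/-- An element of an additive group killed by two coprime integers is zero. -/
lemma eq_zero_of_coprime_nsmul {A : Type*} [AddCommGroup A] {m n : ℕ} (h : m.Coprime n) {a : A}
    (hm : m • a = 0) (hn : n • a = 0) : a = 0 := by
  rw [← addOrderOf_dvd_iff_nsmul_eq_zero] at hm hn
  exact AddMonoid.addOrderOf_eq_one_iff.mp (Nat.eq_one_of_dvd_coprimes h hm hn)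

/-- Functoriality of `H¹` commutes with restriction. -/
lemma ContH1.map_res {G H A B : Type*} [Group G] [TopologicalSpace G] [Group H]
    [TopologicalSpace H] [AddCommGroup A] [AddCommGroup B] (ρ : G →* AddMonoid.End A)
    (τ : H →* AddMonoid.End B) {N N' : Subgroup G} {K K' : Subgroup H} (hN : N' ≤ N)
    (hK : K' ≤ K) (φ : K →ₜ* N) (φ' : K' →ₜ* N') (hφ : ∀ k : K', (φ' k : G) = φ ⟨k, hK k.2⟩)
    (f : A →+ B) (hf : ∀ (k : K) (a : A), f (ρ (φ k) a) = τ k (f a))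
    (hf' : ∀ (k : K') (a : A), f (ρ (φ' k) a) = τ k (f a)) (x : ContH1 (ρ.comp N.subtype)) :
    ContH1.map (ρ := ρ.comp N'.subtype) (τ := τ.comp K'.subtype) φ' f hf' (ContH1.res ρ hN x) =
      ContH1.res τ hK
        (ContH1.map (ρ := ρ.comp N.subtype) (τ := τ.comp K.subtype) φ f hf x) := by
  obtain ⟨c, rfl⟩ := QuotientAddGroup.mk_surjective x
  have h : contCocyclesMap (ρ := ρ.comp N'.subtype) (τ := τ.comp K'.subtype) φ' f hf'
      (contCocyclesMap ⟨Subgroup.inclusion hN, continuous_inclusion hN⟩ (AddMonoidHom.id A)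
        (fun _ _ => rfl) c) =
      contCocyclesMap ⟨Subgroup.inclusion hK, continuous_inclusion hK⟩ (AddMonoidHom.id B)
        (fun _ _ => rfl)
        (contCocyclesMap (ρ := ρ.comp N.subtype) (τ := τ.comp K.subtype) φ f hf c) := by
    ext k
    exact congrArg (fun n => f (c.1 n)) (Subtype.ext (hφ k))
  exact congrArg QuotientAddGroup.mk h

/-! ### The Galois groups over `ℚ^cyc` and `ℚ(μ_{p^∞})` -/

/-- For a normal extension `L₂`, an automorphism that is trivial on `L₁ ∩ L₂` is the product of one
that is trivial on `L₁` and one that is trivial on `L₂`. -/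
lemma InfiniteGalois.fixingSubgroup_inf_le {k K : Type*} [Field k] [Field K] [Algebra k K]
    [IsGalois k K] (L₁ L₂ : IntermediateField k K) [Normal k L₂] :
    (L₁ ⊓ L₂).fixingSubgroup ≤ L₁.fixingSubgroup ⊔ L₂.fixingSubgroup := by
  have hn : L₂.fixingSubgroup.Normal := by
    rw [← IntermediateField.restrictNormalHom_ker]
    infer_instance
  -- By normality the join is the product set of two compact groups, hence closed; the Galois
  -- correspondence then reduces the claim to fixed fields.
  have hclosed : IsClosed ((L₁.fixingSubgroup ⊔ L₂.fixingSubgroup : Subgroup Gal(K/k)) :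
      Set Gal(K/k)) := by
    rw [Subgroup.mul_normal]
    exact ((InfiniteGalois.fixingSubgroup_isClosed L₁).isCompact.mul
      (InfiniteGalois.fixingSubgroup_isClosed L₂).isCompact).isClosed
  have h := InfiniteGalois.fixingSubgroup_fixedField
    (⟨L₁.fixingSubgroup ⊔ L₂.fixingSubgroup, hclosed⟩ : ClosedSubgroup Gal(K/k))
  refine le_trans ?_ h.le
  apply IntermediateField.fixingSubgroup_antitone
  refine le_inf ?_ ?_
  · conv_rhs => rw [← InfiniteGalois.fixedField_fixingSubgroup L₁]
    exact IntermediateField.fixedField_antitone le_sup_left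
  · conv_rhs => rw [← InfiniteGalois.fixedField_fixingSubgroup L₂]
    exact IntermediateField.fixedField_antitone le_sup_right

lemma mem_DeltaGroup_iff (p : ℕ) (g : Gal(QMu p/ℚ)) :
    g ∈ DeltaGroup p ↔ ∀ x : QMu p, (x : QBar) ∈ QCyc p → g x = x := by
  rw [DeltaGroup, IntermediateField.mem_fixingSubgroup_iff]
  exact forall_congr' fun x => by rw [QCyc, IntermediateField.mem_lift]

lemma restrictNormalHom_mem_DeltaGroup_iff (p : ℕ) (s : Gal(QBar/ℚ)) :
    AlgEquiv.restrictNormalHom (QMu p) s ∈ DeltaGroup p ↔ s ∈ (QCyc p).fixingSubgroup := by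
  rw [mem_DeltaGroup_iff, IntermediateField.mem_fixingSubgroup_iff]
  have h : ∀ x : QMu p, AlgEquiv.restrictNormalHom (QMu p) s x = s x :=
    AlgEquiv.restrictNormal_commutes s (QMu p)
  constructor
  · intro hs x hx
    rw [← h ⟨x, QCyc_le_QMu p hx⟩, hs _ hx]
  · intro hs x hx
    ext
    rw [h, hs _ hx]

/-- Since `L` need not lie in `ℚ_S`, an automorphism of `ℚ_S` sees only `L ∩ ℚ_S`. -/
lemma restrictNormalHom_mem_GalS_iff (S : Finset Nat.Primes) (L : IntermediateField ℚ QBar)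
    (s : Gal(QBar/ℚ)) :
    AlgEquiv.restrictNormalHom (QMax S) s ∈ GalS S L ↔ s ∈ (L ⊓ QMax S).fixingSubgroup := by
  have h : ∀ x : QMax S, AlgEquiv.restrictNormalHom (QMax S) s x = s x :=
    AlgEquiv.restrictNormal_commutes s (QMax S)
  rw [IntermediateField.mem_fixingSubgroup_iff]
  constructor
  · rintro hs x ⟨hx, hx'⟩
    rw [← h ⟨x, hx'⟩, hs _ hx]
  · intro hs x hx
    ext
    rw [h, hs _ ⟨hx, x.2⟩]

instance (S : Finset Nat.Primes) : IsGalois ℚ (QMax S) where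

/-- The restriction homomorphism `Gal(QBar/ℚ) → Gal(ℚ_S/ℚ)`. -/
noncomputable def restrictQMax (S : Finset Nat.Primes) : Gal(QBar/ℚ) →* Gal(QMax S/ℚ) :=
  AlgEquiv.restrictNormalHom (QMax S)

lemma restrictQMax_ker (S : Finset Nat.Primes) :
    (restrictQMax S).ker = (QMax S).fixingSubgroup :=
  IntermediateField.restrictNormalHom_ker _

/-- Restriction `Gal(QBar/L) → Gal(ℚ_S/ℚ)` has image `G_S(L)`. -/
lemma map_fixingSubgroup_eq_GalS (S : Finset Nat.Primes) (L : IntermediateField ℚ QBar) :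
    L.fixingSubgroup.map (restrictQMax S) = GalS S L := by
  apply le_antisymm
  · rw [Subgroup.map_le_iff_le_comap]
    intro s hs
    exact (restrictNormalHom_mem_GalS_iff S L s).mpr
      (IntermediateField.fixingSubgroup_antitone inf_le_left hs)
  · intro g hg
    obtain ⟨s, rfl⟩ := AlgEquiv.restrictNormalHom_surjective (F := ℚ) (K₁ := QMax S) QBar g
    -- The lift `s` fixes only `L ∩ ℚ_S`. Writing it as `a b` with `a` trivial on `L` and `b`
    -- trivial on `ℚ_S`, the factor `a` has the same restriction.
    have hs := InfiniteGalois.fixingSubgroup_inf_le _ _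
      ((restrictNormalHom_mem_GalS_iff S L s).mp hg)
    rw [← restrictQMax_ker] at hs
    obtain ⟨a, ha, b, hb, rfl⟩ := Subgroup.mem_sup_of_normal_right.mp hs
    rw [MonoidHom.mem_ker] at hb
    exact ⟨a, ha, (by rw [map_mul, hb, mul_one] : restrictQMax S a = restrictQMax S (a * b))⟩

/-- Used twice: for compactness, which makes cohomology `p`-primary, and for openness of the
finite-index subgroup in corestriction. -/
lemma GalS_isClosed (S : Finset Nat.Primes) (L : IntermediateField ℚ QBar) :
    IsClosed (GalS S L : Set Gal(QMax S/ℚ)) := by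
  have h : GalS S L = (L.comap (QMax S).val).fixingSubgroup := by
    ext g
    rw [IntermediateField.mem_fixingSubgroup_iff]
    rfl
  rw [h]
  exact InfiniteGalois.fixingSubgroup_isClosed _

instance (S : Finset Nat.Primes) (L : IntermediateField ℚ QBar) : CompactSpace (GalS S L) :=
  isCompact_iff_compactSpace.mp (GalS_isClosed S L).isCompact

/-- The relative index is the order of the image of `Gal(QBar/ℚ^cyc)` in `Gal(ℚ(μ_{p^∞})/ℚ)`, and
this image lies in `Δ`. -/
lemma relIndex_fixingSubgroup_dvd_card_DeltaGroup (p : ℕ) :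
    (QMu p).fixingSubgroup.relIndex (QCyc p).fixingSubgroup ∣ Nat.card (DeltaGroup p) := by
  rw [← IntermediateField.restrictNormalHom_ker, Subgroup.relIndex_ker]
  refine Subgroup.card_dvd_of_le ?_
  rw [Subgroup.map_le_iff_le_comap]
  exact fun s hs => (restrictNormalHom_mem_DeltaGroup_iff p s).mpr hs

/-- Pulled back to `Gal(QBar/ℚ)`, the group `G_S(ℚ(μ_{p^∞}))` contains `Gal(QBar/ℚ(μ_{p^∞}))`, so
the index divides the one over `QBar`. -/
lemma relIndex_GalS_dvd_card_DeltaGroup (p : ℕ) (S : Finset Nat.Primes) :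
    (GalS S (QMu p)).relIndex (GalS S (QCyc p)) ∣ Nat.card (DeltaGroup p) := by
  rw [← map_fixingSubgroup_eq_GalS S (QCyc p), ← Subgroup.relIndex_comap]
  refine (Subgroup.relIndex_dvd_of_le_left _ ?_).trans
    (relIndex_fixingSubgroup_dvd_card_DeltaGroup p)
  rw [← Subgroup.map_le_iff_le_comap, map_fixingSubgroup_eq_GalS]

/-! ### Decomposition groups and local indices -/

section Local

variable {l : ℕ} [Fact l.Prime]

/-- The homomorphism `Gal(QlBar l/ℚ_l) → Gal(L/ℚ)` defined by an embedding `σ`, for a normal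
extension `L` of `ℚ`. -/
noncomputable def decompNormal (σ : QBar →ₐ[ℚ] QlBar l) (L : IntermediateField ℚ QBar)
    [Normal ℚ L] : Gal(QlBar l/ℚ_[l]) →* Gal(L/ℚ) :=
  letI := (σ.comp L.val).toRingHom.toAlgebra
  haveI : IsScalarTower ℚ L (QlBar l) :=
    IsScalarTower.of_algebraMap_eq' (Subsingleton.elim _ _)
  (AlgEquiv.restrictNormalHom (F := ℚ) (K₁ := QlBar l) L).comp
    (AlgEquiv.restrictScalarsHom ℚ)

lemma decompNormal_spec (σ : QBar →ₐ[ℚ] QlBar l) (L : IntermediateField ℚ QBar) [Normal ℚ L]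
    (τ : Gal(QlBar l/ℚ_[l])) (x : L) : σ (decompNormal σ L τ x : L) = τ (σ x) := by
  let := (σ.comp L.val).toRingHom.toAlgebra
  have : IsScalarTower ℚ L (QlBar l) :=
    IsScalarTower.of_algebraMap_eq' (Subsingleton.elim _ _)
  exact AlgEquiv.restrictNormal_commutes (F := ℚ) (K₁ := QlBar l) (K₂ := QlBar l)
    (τ.restrictScalars ℚ) L x

lemma mem_fixingSubgroup_localField_iff (σ : QBar →ₐ[ℚ] QlBar l) (L : IntermediateField ℚ QBar)
    (τ : Gal(QlBar l/ℚ_[l])) :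
    τ ∈ (localField σ L).fixingSubgroup ↔ ∀ x ∈ L, τ (σ x) = σ x := by
  constructor
  · intro h x hx
    exact (IntermediateField.mem_fixingSubgroup_iff _ _).mp h _
      (IntermediateField.subset_adjoin _ _ ⟨x, hx, rfl⟩)
  · intro h
    -- The elements fixed by `τ` form a field over `ℚ_l`, so it suffices to test generators.
    have hle : localField σ L ≤ IntermediateField.fixedField (Subgroup.zpowers τ) := by
      rw [localField, IntermediateField.adjoin_le_iff]
      rintro _ ⟨x, hx, rfl⟩
      rw [SetLike.mem_coe, IntermediateField.mem_fixedField_iff]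
      have hz : Subgroup.zpowers τ ≤ MulAction.stabilizer Gal(QlBar l/ℚ_[l]) (σ x) := by
        rw [Subgroup.zpowers_le]
        exact h x hx
      exact fun f hf => hz hf
    rw [IntermediateField.mem_fixingSubgroup_iff]
    exact fun y hy => (IntermediateField.mem_fixedField_iff _ _).mp (hle hy) _
      (Subgroup.mem_zpowers _)

lemma decompNormal_ker (σ : QBar →ₐ[ℚ] QlBar l) (L : IntermediateField ℚ QBar) [Normal ℚ L] :
    (decompNormal σ L).ker = (localField σ L).fixingSubgroup := by
  ext τ
  rw [mem_fixingSubgroup_localField_iff, MonoidHom.mem_ker]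
  constructor
  · intro h x hx
    rw [← decompNormal_spec σ L τ ⟨x, hx⟩, h]
    rfl
  · intro h
    ext x
    apply σ.toRingHom.injective
    change σ (decompNormal σ L τ x : L) = σ x
    rw [decompNormal_spec, h x x.2]

lemma fixingSubgroup_localField_anti (σ : QBar →ₐ[ℚ] QlBar l) {L L' : IntermediateField ℚ QBar}
    (h : L ≤ L') : (localField σ L').fixingSubgroup ≤ (localField σ L).fixingSubgroup :=
  IntermediateField.fixingSubgroup_antitone
    (IntermediateField.adjoin.mono _ _ _ (Set.image_mono h))

/-- By `decompNormal_ker` the index is the order of the image of the local Galois group over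
`ℚ^cyc`; this image fixes `ℚ^cyc`, hence lies in `Δ`. -/
lemma relIndex_localField_dvd_card_DeltaGroup (p : ℕ) (σ : QBar →ₐ[ℚ] QlBar l) :
    (localField σ (QMu p)).fixingSubgroup.relIndex (localField σ (QCyc p)).fixingSubgroup ∣
      Nat.card (DeltaGroup p) := by
  rw [← decompNormal_ker, Subgroup.relIndex_ker]
  refine Subgroup.card_dvd_of_le ?_
  rw [Subgroup.map_le_iff_le_comap]
  intro τ hτ
  refine (mem_DeltaGroup_iff p _).mpr fun x hx => ?_
  ext
  apply σ.toRingHom.injective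
  change σ (decompNormal σ (QMu p) τ x : QMu p) = σ x
  rw [decompNormal_spec, (mem_fixingSubgroup_localField_iff σ _ τ).mp hτ x hx]

/-- Localization commutes with restriction. -/
lemma localization_restriction (E : WeierstrassCurve ℚ) (p : ℕ) (S : Finset Nat.Primes)
    (σ : QBar →ₐ[ℚ] QlBar l) (c : GlobalH1 E p S (QCyc p)) :
    localization E p S σ (QMu p) (restriction E p S c) =
      ContH1.res (EPoint.galAction E ℚ_[l] (QlBar l))
        (fixingSubgroup_localField_anti σ (QCyc_le_QMu p)) (localization E p S σ (QCyc p) c) := by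
  exact ContH1.map_res (torsionModule E p S) (EPoint.galAction E ℚ_[l] (QlBar l))
    (GalS_anti S (QCyc_le_QMu p)) (fixingSubgroup_localField_anti σ (QCyc_le_QMu p))
    (localToGlobal S σ _) (localToGlobal S σ _) (fun _ => rfl) (torsionToLocal E p S σ) _ _ c

end Local

/-! ### Selmer groups -/

lemma mem_Selmer_iff (E : WeierstrassCurve ℚ) (p : ℕ) (S : Finset Nat.Primes)
    (L : IntermediateField ℚ QBar) (c : GlobalH1 E p S L) :
    c ∈ Selmer E p S L ↔ ∀ l : {l : Nat.Primes // l ∈ S},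
      haveI : Fact (l.1 : ℕ).Prime := ⟨l.1.2⟩
      ∀ σ : QBar →ₐ[ℚ] QlBar l.1, localization E p S σ L c = 0 := by
  rw [Selmer, AddMonoidHom.mem_ker, funext_iff]
  exact forall_congr' fun l => funext_iff

lemma GlobalH1.exists_pow_nsmul_eq_zero (E : WeierstrassCurve ℚ) (p : ℕ) (S : Finset Nat.Primes)
    (L : IntermediateField ℚ QBar) (c : GlobalH1 E p S L) : ∃ k : ℕ, p ^ k • c = 0 :=
  ContH1.exists_pow_nsmul_eq_zero p (fun a => by
    obtain ⟨k, hk⟩ := a.2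
    exact ⟨k, Subtype.ext hk⟩) c

lemma finite_quotient_of_relIndex_dvd {G : Type*} [Group G] {N M : Subgroup G} {n : ℕ}
    (hn : n ≠ 0) (h : N.relIndex M ∣ n) : Finite (M ⧸ N.subgroupOf M) :=
  (Nat.card_ne_zero.mp fun h0 => hn (Nat.eq_zero_of_zero_dvd (h0 ▸ h))).2

lemma restriction_injective (E : WeierstrassCurve ℚ) (p : ℕ) [Fact p.Prime] (hodd : Odd p)
    (S : Finset Nat.Primes) : Function.Injective (restriction E p S) := by
  rw [injective_iff_map_eq_zero]
  intro c hc
  obtain ⟨k, hk⟩ := GlobalH1.exists_pow_nsmul_eq_zero E p S _ c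
  have hdvd := relIndex_GalS_dvd_card_DeltaGroup p S
  have hcop := DeltaGroup.card_coprime p hodd
  have := finite_quotient_of_relIndex_dvd (DeltaGroup.card_ne_zero p hodd) hdvd
  exact eq_zero_of_coprime_nsmul ((hcop.coprime_dvd_left hdvd).pow_right k)
    (ContH1.relIndex_nsmul_eq_zero _ _ c hc) hk

/-- A class over `ℚ^cyc` that restricts to a Selmer class is a Selmer class. -/
lemma mem_Selmer_of_restriction_mem (E : WeierstrassCurve ℚ) (p : ℕ) [Fact p.Prime] (hodd : Odd p)
    (S : Finset Nat.Primes) {c : GlobalH1 E p S (QCyc p)}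
    (hc : restriction E p S c ∈ Selmer E p S (QMu p)) : c ∈ Selmer E p S (QCyc p) := by
  rw [mem_Selmer_iff] at hc ⊢
  intro l
  have : Fact (l.1 : ℕ).Prime := ⟨l.1.2⟩
  intro σ
  have h := hc l σ
  rw [localization_restriction] at h
  obtain ⟨k, hk⟩ := GlobalH1.exists_pow_nsmul_eq_zero E p S _ c
  have hdvd := relIndex_localField_dvd_card_DeltaGroup p σ
  have hcop := DeltaGroup.card_coprime p hodd
  have := finite_quotient_of_relIndex_dvd (DeltaGroup.card_ne_zero p hodd) hdvd
  -- The coefficients `E(QlBar l)` are not `p`-primary; the power of `p` killing the local class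
  -- comes from the global class `c`.
  refine eq_zero_of_coprime_nsmul ((hcop.coprime_dvd_left hdvd).pow_right k)
    (ContH1.relIndex_nsmul_eq_zero _ _ _ h) ?_
  rw [← map_nsmul, hk, map_zero]

lemma restriction_mem_SelmerMuDelta (E : WeierstrassCurve ℚ) (p : ℕ) (S : Finset Nat.Primes)
    {c : GlobalH1 E p S (QCyc p)} (hc : c ∈ Selmer E p S (QCyc p)) :
    restriction E p S c ∈ SelmerMuDelta E p S := by
  refine ⟨?_, fun s hs => ?_⟩
  · rw [mem_Selmer_iff] at hc ⊢
    intro l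
    have : Fact (l.1 : ℕ).Prime := ⟨l.1.2⟩
    intro σ
    rw [localization_restriction, hc l σ, map_zero]
  · refine ContH1.conj_res _ _ c ?_
    rw [← map_fixingSubgroup_eq_GalS]
    exact ⟨s, (restrictNormalHom_mem_DeltaGroup_iff p s).mp hs, rfl⟩

lemma exists_restriction_eq (E : WeierstrassCurve ℚ) (p : ℕ) [Fact p.Prime] (hodd : Odd p)
    (S : Finset Nat.Primes) {x : GlobalH1 E p S (QMu p)} (hx : x ∈ SelmerMuDelta E p S) :
    ∃ c, restriction E p S c = x := by
  have hdvd := relIndex_GalS_dvd_card_DeltaGroup p S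
  have hcop := DeltaGroup.card_coprime p hodd
  have := finite_quotient_of_relIndex_dvd (DeltaGroup.card_ne_zero p hodd) hdvd
  -- A closed subgroup of finite index is open.
  have hopen : IsOpen ((GalS S (QMu p)).subgroupOf (GalS S (QCyc p)) : Set (GalS S (QCyc p))) := by
    have : ((GalS S (QMu p)).subgroupOf (GalS S (QCyc p))).FiniteIndex :=
      Subgroup.finiteIndex_of_finite_quotient
    exact Subgroup.isOpen_of_isClosed_of_finiteIndex _
      ((GalS_isClosed S (QMu p)).preimage continuous_subtype_val)
  obtain ⟨y, hy⟩ := ContH1.exists_res_eq_relIndex_nsmul (torsionModule E p S)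
    (GalS_anti S (QCyc_le_QMu p)) hopen x (by
      intro s hs
      rw [← map_fixingSubgroup_eq_GalS] at hs
      obtain ⟨s, hs, rfl⟩ := hs
      exact hx.2 s ((restrictNormalHom_mem_DeltaGroup_iff p s).mpr hs))
  obtain ⟨k, hk⟩ := GlobalH1.exists_pow_nsmul_eq_zero E p S _ x
  have hco : IsCoprime (((GalS S (QMu p)).relIndex (GalS S (QCyc p)) : ℕ) : ℤ) ((p ^ k : ℕ) : ℤ) :=
    Nat.isCoprime_iff_coprime.mpr ((hcop.coprime_dvd_left hdvd).pow_right k)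
  obtain ⟨u, v, huv⟩ := hco
  -- With `m` the index, `u m + v p^k = 1` and `p^k x = 0`, so `u • y` restricts to `u m x = x`.
  refine ⟨u • y, ?_⟩
  have hy' : restriction E p S y = (GalS S (QMu p)).relIndex (GalS S (QCyc p)) • x := hy
  rw [map_zsmul, hy', ← natCast_zsmul, ← mul_smul, eq_sub_of_add_eq huv, sub_smul, mul_smul,
    natCast_zsmul, hk, smul_zero, sub_zero, one_smul]

/-- An injective homomorphism restricts to an isomorphism from a subgroup onto its image. -/
lemma exists_addEquiv_of_restrict {X Y : Type*} [AddCommGroup X] [AddCommGroup Y] (r : X →+ Y)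
    (hr : Function.Injective r) (U : AddSubgroup X) (V : AddSubgroup Y) (hUV : ∀ x ∈ U, r x ∈ V)
    (hVU : ∀ y ∈ V, ∃ x, x ∈ U ∧ r x = y) : ∃ e : U ≃+ V, ∀ x : U, (e x : Y) = r x := by
  let f : U →+ V := (r.comp U.subtype).codRestrict V fun x => hUV x x.2
  have hf : Function.Bijective f := by
    refine ⟨fun a b hab => Subtype.ext (hr (congrArg Subtype.val hab)), fun y => ?_⟩
    obtain ⟨x, hx, hxy⟩ := hVU y y.2
    exact ⟨⟨x, hx⟩, Subtype.ext hxy⟩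
  exact ⟨AddEquiv.ofBijective f hf, fun _ => rfl⟩

theorem lemma3p8 (p : ℕ) [Fact p.Prime] (hp : 5 ≤ p)
    (E : WeierstrassCurve ℚ) [E.IsElliptic] (hE : HasGoodOrdinaryReductionAt E p)
    (S : Finset Nat.Primes) (hpS : ⟨p, Fact.out⟩ ∈ S)
    (hbad : ∀ (l : ℕ) [hl : Fact l.Prime], ¬ HasGoodReductionAt E l → ⟨l, hl.out⟩ ∈ S) :
    ∃ e : Selmer E p S (QCyc p) ≃+ SelmerMuDelta E p S,
      ∀ c : Selmer E p S (QCyc p),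
        (e c : GlobalH1 E p S (QMu p)) = restriction E p S (c : GlobalH1 E p S (QCyc p)) := by
  have hodd : Odd p := (Fact.out : p.Prime).odd_of_ne_two (by omega)
  exact exists_addEquiv_of_restrict (restriction E p S) (restriction_injective E p hodd S) _ _
    (fun _ => restriction_mem_SelmerMuDelta E p S) fun x hx => by
      obtain ⟨c, hc⟩ := exists_restriction_eq E p hodd S hx
      exact ⟨c, mem_Selmer_of_restriction_mem E p hodd S (by rw [hc]; exact hx.1), hc⟩
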